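/- A word $u$ is an interleaving of words $w$ and $v$ if the positions of $u$ can be split into two disjoint sets, on which $u$ reads $w$ and $v$ respectively; $w\,\|\,v$ is the set of all interleavings, and $L\,\|\,K=\bigcup_{w\in L,\,v\in K} w\,\|\,v$ for languages $L,K$. **trPCCFL.** A *partially-commutative context-free grammar* over a finite alphabet consists of a finite set $V$ of non-terminals, an initial non-terminal $S\in V$, finitely many productions $X\xrightarrow{a}\alpha$ (with $X\in V$, $a$ a letter, $\alpha\in V^*$), and a symmetric irreflexive independence relation $I\subseteq V\times V$; its complement $D=(V\times V)\setminus I$ is the dependence relation. Its steps on configurations in $V^*$ are $X\beta\xrightarrow{a}\alpha\beta$ for a production $X\xrightarrow{a}\alpha$, and the unlabelled swaps $\alpha XY\beta\to\alpha YX\beta$ for $(X,Y)\in I$. The generated language is the set of words read along finite sequences of steps from $S$ to $\varepsilon$. $\mathrm{trPCCFL}$ is the class of languages generated by such grammars whose dependence relation $D$ is transitive. **shuffle-CFL.** A *PA grammar* over a finite alphabet consists of a finite set of non-terminals, an initial non-terminal $S$, and finitely many productions $X\xrightarrow{a}t$, with $a$ a letter and $t$ a term built from non-terminals and the empty term $\varepsilon$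 by sequential composition $;$ and parallel composition $\|$. Terms are taken up to the least congruence that makes both operations associative with neutral element $\varepsilon$, and $\|$ commutative. The steps are the least relation containing all productions such that $t\xrightarrow{a}t'$ implies $t;u\xrightarrow{a}t';u$, $\ t\,\|\,u\xrightarrow{a}t'\,\|\,u$ and $u\,\|\,t\xrightarrow{a}u\,\|\,t'$. The generated language is the set of words read along sequences of steps from $S$ to $\varepsilon$. $\text{shuffle-CFL}$ is the class of languages generated by PA grammars. **trace-CFL.** Given a symmetric irreflexive relation on the letters of a finite alphabet, two words are trace equivalent if one can be transformed into the other by swaps of neighbouring related letters. The trace closure of a language $L$ is the set of words that are trace equivalent to some word of $L$. $\text{trace-CFL}$ is the class of trace closures of context-free languages. **Theorem.** 1. $\mathrm{trPCCFL}\cap\text{shuffle-CFL}\not\subseteq\text{trace-CFL}$. 2. $\mathrm{trPCCFL}\cap\text{trace-CFL}\not\subseteq\text{shuffle-CFL}$. This is witnessed by the language $$L_3=\bigcup_{n\ge 0}a^n\,s\,(b^n\,\|\,c^n)$$ over the alphabet $\{a,b,c,s\}$: $L_3$ belongs to $\mathrm{trPCCFL}$ and to $\text{trace-CFL}$, but not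 to $\text{shuffle-CFL}$. -/

import Mathlib

/-! Partially-commutative context-free grammars, process-algebra grammars, trace closures of
context-free languages, and the three classes of languages they define. -/

namespace PartialComm

/-- `Interleaving u v w`: the word `w` is an interleaving of `u` and `v`, i.e. `w ∈ u ‖ v`. -/
inductive Interleaving {T : Type} : List T → List T → List T → Prop
  | nil : Interleaving [] [] []
  | left (x : T) {u v w : List T} : Interleaving u v w → Interleaving (x :: u) v (x :: w)
  | right (x : T) {u v w : List T} : Interleaving u v w → Interleaving u (x :: v) (x :: w)

/-- A finite sequence of steps, each labelled by a word, from one configuration to another one,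
together with the concatenation of the labels. -/
inductive Derives {T C : Type} (step : C → List T → C → Prop) : C → List T → C → Prop
  | nil (c : C) : Derives step c [] c
  | cons {c d e : C} {u v : List T} :
      step c u d → Derives step d v e → Derives step c (u ++ v) e

/-- A Greibach context-free grammar over the alphabet `T`, equipped with a symmetric and
irreflexive independence relation on its non-terminals. A production `X →ᵃ α` is the triple
`(X, a, α)`. -/
structure PCGrammar (T : Type) where
  NT : Type
  finite_NT : Finite NT
  initial : NT
  productions : Set (NT × T × List NT)
  finite_productions : productions.Finite
  Indep : NT → NT → Prop
  indep_symm : ∀ X Y, Indep X Y → Indep Y X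
  indep_irrefl : ∀ X, ¬ Indep X X

namespace PCGrammar

variable {T : Type} (G : PCGrammar T)

/-- The dependence relation: the complement of independence. -/
def Dep (X Y : G.NT) : Prop := ¬ G.Indep X Y

/-- The dependence relation is transitive. -/
def TransitiveDependence : Prop := ∀ X Y Z, G.Dep X Y → G.Dep Y Z → G.Dep X Z

/-- Steps between configurations. A production step is labelled by its letter,
a swap step by the empty word. -/
inductive Step : List G.NT → List T → List G.NT → Prop
  | production {X : G.NT} {a : T} {α : List G.NT} (β : List G.NT) :
      (X, a, α) ∈ G.productions → Step (X :: β) [a] (α ++ β)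
  | swap {X Y : G.NT} (α β : List G.NT) :
      G.Indep X Y → Step (α ++ X :: Y :: β) [] (α ++ Y :: X :: β)

/-- The set of words generated by the initial non-terminal. -/
def language : Language T := {w | Derives G.Step [G.initial] w []}

end PCGrammar

/-- Terms built from non-terminals and the empty term by sequential and parallel composition. -/
inductive PATerm (V : Type) : Type
  | empty : PATerm V
  | var : V → PATerm V
  | seq : PATerm V → PATerm V → PATerm V
  | par : PATerm V → PATerm V → PATerm V

/-- Structural equivalence of terms: the least congruence for which both compositions are
associative with neutral element the empty term, and parallel composition is commutative. -/
inductive StructEquiv {V : Type} : PATerm V → PATerm V → Prop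
  | refl (t : PATerm V) : StructEquiv t t
  | symm {t u : PATerm V} : StructEquiv t u → StructEquiv u t
  | trans {t u v : PATerm V} : StructEquiv t u → StructEquiv u v → StructEquiv t v
  | seq_congr {t t' u u' : PATerm V} :
      StructEquiv t t' → StructEquiv u u' → StructEquiv (.seq t u) (.seq t' u')
  | par_congr {t t' u u' : PATerm V} :
      StructEquiv t t' → StructEquiv u u' → StructEquiv (.par t u) (.par t' u')
  | seq_assoc (t u v : PATerm V) : StructEquiv (.seq (.seq t u) v) (.seq t (.seq u v))
  | par_assoc (t u v : PATerm V) : StructEquiv (.par (.par t u) v) (.par t (.par u v))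
  | par_comm (t u : PATerm V) : StructEquiv (.par t u) (.par u t)
  | empty_seq (t : PATerm V) : StructEquiv (.seq .empty t) t
  | seq_empty (t : PATerm V) : StructEquiv (.seq t .empty) t
  | empty_par (t : PATerm V) : StructEquiv (.par .empty t) t
  | par_empty (t : PATerm V) : StructEquiv (.par t .empty) t

/-- A process-algebra (PA) grammar over the alphabet `T`. A production `X →ᵃ t` is the triple
`(X, a, t)`. -/
structure PAGrammar (T : Type) where
  NT : Type
  finite_NT : Finite NT
  initial : NT
  productions : Set (NT × T × PATerm NT)
  finite_productions : productions.Finite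

namespace PAGrammar

variable {T : Type} (G : PAGrammar T)

/-- Steps between terms, each labelled by a letter. The rule `struct` expresses that terms are
considered up to structural equivalence. -/
inductive Step : PATerm G.NT → T → PATerm G.NT → Prop
  | production {X : G.NT} {a : T} {t : PATerm G.NT} :
      (X, a, t) ∈ G.productions → Step (.var X) a t
  | seq {t t' : PATerm G.NT} {a : T} (u : PATerm G.NT) :
      Step t a t' → Step (.seq t u) a (.seq t' u)
  | par_left {t t' : PATerm G.NT} {a : T} (u : PATerm G.NT) :
      Step t a t' → Step (.par t u) a (.par t' u)
  | par_right {u u' : PATerm G.NT} {a : T} (t : PATerm G.NT) :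
      Step u a u' → Step (.par t u) a (.par t u')
  | struct {t t' u u' : PATerm G.NT} {a : T} :
      StructEquiv t t' → Step t' a u' → StructEquiv u' u → Step t a u

/-- The set of words defined by derivations from the initial non-terminal to the empty term. -/
def language : Language T :=
  {w | Derives (fun t u t' => ∃ a, u = [a] ∧ G.Step t a t') (.var G.initial) w .empty}

end PAGrammar

/-- One word is obtained from the other by swapping two neighbouring independent letters. -/
inductive LetterSwap {T : Type} (I : T → T → Prop) : List T → List T → Prop
  | swap {a b : T} (u v : List T) : I a b → LetterSwap I (u ++ a :: b :: v) (u ++ b :: a :: v)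

/-- One word may be transformed into the other by swaps of neighbouring independent letters. -/
def TraceEquiv {T : Type} (I : T → T → Prop) : List T → List T → Prop :=
  Relation.ReflTransGen (LetterSwap I)

/-- The trace closure of a language. -/
def traceClosure {T : Type} (I : T → T → Prop) (L : Language T) : Language T :=
  {w | ∃ v ∈ L, TraceEquiv I w v}

/-- The class trPCCFL, over the alphabet `T`: languages of partially-commutative context-free
grammars with a transitive dependence relation. -/
def TrPCCFL (T : Type) : Set (Language T) :=
  {L | ∃ G : PCGrammar T, G.TransitiveDependence ∧ G.language = L}

/-- The class shuffle-CFL, over the alphabet `T`: languages of PA grammars. -/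
def ShuffleCFL (T : Type) : Set (Language T) :=
  {L | ∃ G : PAGrammar T, G.language = L}

/-- The class trace-CFL, over the alphabet `T`: trace closures of context-free languages with
respect to independence relations on letters. -/
def TraceCFL (T : Type) : Set (Language T) :=
  {L | ∃ I : T → T → Prop, (∀ a b, I a b → I b a) ∧ (∀ a, ¬ I a a) ∧
    ∃ K : Language T, K.IsContextFree ∧ traceClosure I K = L}

/-- The four-letter alphabet `{a, b, c, s}`. -/
inductive Letter : Type
  | a
  | b
  | c
  | s

/-- The language `⋃ₙ aⁿ s (bⁿ ‖ cⁿ)`, with `n ≥ 0`. -/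
def L₃ : Language Letter :=
  {w | ∃ (n : ℕ) (v : List Letter),
    Interleaving (List.replicate n Letter.b) (List.replicate n Letter.c) v ∧
    w = List.replicate n Letter.a ++ Letter.s :: v}

end PartialComm

/-!
Both non-membership proofs rest on the same observation. In a grammar whose words `w` satisfy
`#a w = #b w = #c w`, a part of a derivation occurs in a context that fixes the differences
`#a - #b` and `#b - #c` of whatever the part derives. As there are finitely many kinds of parts,
these differences are bounded by a constant `D` for all parts. Descending along a derivation of
`aⁿ bⁿ cⁿ` or `aⁿ s bⁿ cⁿ` one finds a part that reads a factor of intermediate size: it is nearly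
balanced, so that it contains letters on both sides of `bⁿ`, and then all of `bⁿ`, although it is
too short for that. For context-free grammars the descent is controlled by the length. For
process-algebra grammars it follows the letter `s`: it never enters a proper parallel composition,
since the two components could be read in either order and `L₃` fixes what stands on either side of
`s`.

For the positive parts, productions that rewrite multisets of non-terminals are simulated both by
partially-commutative grammars in which distinct non-terminals are independent, and by
process-algebra grammars without sequential composition.
-/

namespace PartialComm

open List (replicate)

instance : DecidableEq Letter := fun x y => by
  cases x <;> cases y <;> first | exact isTrue rfl | exact isFalse (by rintro ⟨⟩)

instance : Fintype Letter := ⟨{.a, .b, .c, .s}, fun x => by cases x <;> decide⟩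

/-! ### Interleavings -/

namespace Interleaving

variable {T : Type} {u v w : List T}

theorem symm (h : Interleaving u v w) : Interleaving v u w := by
  induction h with
  | nil => exact .nil
  | left x _ ih => exact .right x ih
  | right x _ ih => exact .left x ih

theorem nil_left_iff : Interleaving [] v w ↔ w = v := by
  constructor
  · intro h
    generalize hu : ([] : List T) = u at h
    induction h with
    | nil => rfl
    | left x _ _ => cases hu
    | right x _ ih => rw [ih hu]
  · rintro rfl
    induction w with
    | nil => exact .nil
    | cons x w ih => exact .right x ih

theorem nil_right_iff : Interleaving u [] w ↔ w = u :=
  ⟨fun h => nil_left_iff.1 h.symm, fun h => (nil_left_iff.2 h).symm⟩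

theorem append_append {u' v' w' : List T} (h : Interleaving u v w) (h' : Interleaving u' v' w') :
    Interleaving (u ++ u') (v ++ v') (w ++ w') := by
  induction h with
  | nil => exact h'
  | left x _ ih => exact .left x ih
  | right x _ ih => exact .right x ih

theorem append (u v : List T) : Interleaving u v (u ++ v) := by
  simpa only [List.append_nil, List.nil_append] using
    (nil_right_iff.2 rfl : Interleaving u [] u).append_append (nil_left_iff.2 rfl)

theorem pair_cons_append_cons (x y : T) (p q : List T) :
    Interleaving [x, y] (p ++ q) (x :: p ++ y :: q) :=
  .left x ((nil_left_iff.2 rfl : Interleaving [] p p).append_append (.left y (nil_left_iff.2 rfl)))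

theorem assoc {x y : List T} (h : Interleaving x w y) (h' : Interleaving u v x) :
    ∃ z, Interleaving v w z ∧ Interleaving u z y := by
  induction h generalizing u v with
  | nil => cases h'; exact ⟨[], .nil, .nil⟩
  | left a _ ih =>
    cases h' with
    | left _ h' => obtain ⟨z, h₁, h₂⟩ := ih h'; exact ⟨z, h₁, .left a h₂⟩
    | right _ h' => obtain ⟨z, h₁, h₂⟩ := ih h'; exact ⟨a :: z, .left a h₁, .right a h₂⟩
  | right a _ ih => obtain ⟨z, h₁, h₂⟩ := ih h'; exact ⟨a :: z, .right a h₁, .right a h₂⟩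

theorem perm (h : Interleaving u v w) : w.Perm (u ++ v) := by
  induction h with
  | nil => rfl
  | left x _ ih => exact ih.cons x
  | right x _ ih => exact (ih.cons x).trans List.perm_middle.symm

end Interleaving

theorem interleaving_replicate_iff {T : Type} {x y : T} {m n : ℕ} {w : List T} :
    Interleaving (replicate m x) (replicate n y) w ↔
      w.Perm (replicate m x ++ replicate n y) := by
  refine ⟨Interleaving.perm, fun h => ?_⟩
  induction w generalizing m n with
  | nil =>
    obtain ⟨hm, hn⟩ := List.append_eq_nil_iff.1 h.symm.eq_nil
    rw [hm, hn]
    exact .nil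
  | cons z w ih =>
    rcases List.mem_append.1 (h.subset List.mem_cons_self) with hz | hz
    · obtain ⟨hm, rfl⟩ := List.mem_replicate.1 hz
      obtain ⟨m, rfl⟩ := Nat.exists_eq_succ_of_ne_zero hm
      exact .left z (ih h.cons_inv)
    · obtain ⟨hn, rfl⟩ := List.mem_replicate.1 hz
      obtain ⟨n, rfl⟩ := Nat.exists_eq_succ_of_ne_zero hn
      exact .right z (ih (h.trans List.perm_middle).cons_inv)

/-! ### Commutative rewriting -/

/-- Derivations of a context-free grammar in Greibach form whose configurations are
multisets of non-terminals: `CommDerives P M w` means that the productions `P` rewrite `M` to the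
empty multiset while reading `w`. A production `X →ᵃ α` is the triple `(X, a, α)`. -/
inductive CommDerives {V T : Type} (P : Set (V × T × Multiset V)) : Multiset V → List T → Prop
  | nil : CommDerives P 0 []
  | cons {X : V} {a : T} {α M : Multiset V} {w : List T} :
      (X, a, α) ∈ P → CommDerives P (α + M) w → CommDerives P (X ::ₘ M) (a :: w)

/-- The language of the commutative grammar with productions `P` and initial non-terminal `X`. -/
def commLanguage {V T : Type} (P : Set (V × T × Multiset V)) (X : V) : Language T :=
  {w | CommDerives P {X} w}

section CommDerives

variable {V T : Type} {P : Set (V × T × Multiset V)}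

theorem commDerives_cons_iff {M : Multiset V} {a : T} {w : List T} :
    CommDerives P M (a :: w) ↔
      ∃ X α N, M = X ::ₘ N ∧ (X, a, α) ∈ P ∧ CommDerives P (α + N) w := by
  constructor
  · rintro (_ | ⟨hP, h⟩)
    exact ⟨_, _, _, rfl, hP, h⟩
  · rintro ⟨X, α, N, rfl, hP, h⟩
    exact .cons hP h

theorem cons_mem_commLanguage {X : V} {a : T} {α : Multiset V} {w : List T} (hP : (X, a, α) ∈ P)
    (h : CommDerives P α w) : a :: w ∈ commLanguage P X :=
  CommDerives.cons hP ((add_zero α).symm ▸ h)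

theorem CommDerives.interleave {M N : Multiset V} {u v w : List T} (hu : CommDerives P M u)
    (hv : CommDerives P N v) (h : Interleaving u v w) : CommDerives P (M + N) w := by
  induction h generalizing M N with
  | nil =>
    cases hu
    cases hv
    exact .nil
  | left x _ ih =>
    obtain ⟨X, α, M, rfl, hP, hu⟩ := commDerives_cons_iff.1 hu
    rw [Multiset.cons_add]
    exact .cons hP (add_assoc α M N ▸ ih hu hv)
  | right x _ ih =>
    obtain ⟨X, α, N, rfl, hP, hv⟩ := commDerives_cons_iff.1 hv
    rw [Multiset.add_cons]
    exact .cons hP (add_left_comm M α N ▸ ih hu hv)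

end CommDerives

/-! ### Traces -/

section Trace

variable {T : Type} {I : T → T → Prop}

theorem LetterSwap.cons (x : T) {v w : List T} (h : LetterSwap I v w) :
    LetterSwap I (x :: v) (x :: w) := by
  obtain ⟨p, q, hI⟩ := h
  exact .swap (x :: p) q hI

theorem TraceEquiv.cons (x : T) {v w : List T} (h : TraceEquiv I v w) :
    TraceEquiv I (x :: v) (x :: w) := by
  induction h with
  | refl => exact .refl
  | tail _ h ih => exact ih.tail (h.cons x)

theorem TraceEquiv.append_left (u : List T) {v w : List T} (h : TraceEquiv I v w) :
    TraceEquiv I (u ++ v) (u ++ w) := by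
  induction u with
  | nil => exact h
  | cons x u ih => exact ih.cons x

theorem TraceEquiv.perm {v w : List T} (h : TraceEquiv I v w) : v.Perm w := by
  induction h with
  | refl => rfl
  | tail _ h ih =>
    obtain ⟨p, q, _⟩ := h
    exact ih.trans ((List.Perm.swap _ _ q).append_left p)

theorem traceEquiv_of_perm {v w : List T} (hI : {x | x ∈ v}.Pairwise I) (h : v.Perm w) :
    TraceEquiv I v w := by
  induction h with
  | nil => exact .refl
  | cons x _ ih => exact (ih (hI.mono fun _ => List.mem_cons_of_mem x)).cons x
  | swap x y v =>
    rcases eq_or_ne x y with rfl | hxy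
    · exact .refl
    · exact .single (.swap [] v (hI (by simp) (by simp) hxy.symm))
  | trans h _ ih₁ ih₂ =>
    refine (ih₁ hI).trans (ih₂ (hI.mono fun x hx => ?_))
    exact h.mem_iff.2 hx

theorem LetterSwap.exists_of_cons {x : T} {v w : List T} (hx : ∀ y, ¬ I y x)
    (h : LetterSwap I w (x :: v)) : ∃ v', w = x :: v' ∧ LetterSwap I v' v := by
  generalize hu : x :: v = u at h
  obtain ⟨_ | ⟨z, p⟩, q, hI⟩ := h
  · obtain ⟨rfl, -⟩ := List.cons_eq_cons.1 hu
    exact absurd hI (hx _)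
  · obtain ⟨rfl, rfl⟩ := List.cons_eq_cons.1 hu
    exact ⟨_, rfl, .swap p q hI⟩

theorem TraceEquiv.exists_of_cons {x : T} {v w : List T} (hx : ∀ y, ¬ I y x)
    (h : TraceEquiv I w (x :: v)) : ∃ v', w = x :: v' ∧ TraceEquiv I v' v := by
  induction h using Relation.ReflTransGen.head_induction_on with
  | refl => exact ⟨v, rfl, .refl⟩
  | head h _ ih =>
    obtain ⟨_, rfl, hv⟩ := ih
    obtain ⟨v', rfl, hv'⟩ := h.exists_of_cons hx
    exact ⟨v', rfl, .head hv' hv⟩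

theorem traceEquiv_append_left_iff {u v w : List T} (hu : ∀ x ∈ u, ∀ y, ¬ I y x) :
    TraceEquiv I w (u ++ v) ↔ ∃ v', w = u ++ v' ∧ TraceEquiv I v' v := by
  refine ⟨fun h => ?_, fun ⟨v', hw, hv⟩ => hw ▸ hv.append_left u⟩
  induction u generalizing w with
  | nil => exact ⟨w, rfl, h⟩
  | cons x u ih =>
    rw [List.forall_mem_cons] at hu
    obtain ⟨_, rfl, hw⟩ := TraceEquiv.exists_of_cons hu.1 h
    obtain ⟨v', rfl, hv'⟩ := ih hu.2 hw
    exact ⟨v', rfl, hv'⟩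

theorem eq_of_traceEquiv_of_isChain {v w : List T} (hw : w.IsChain fun x y => ¬ I x y)
    (h : TraceEquiv I w v) : v = w := by
  obtain rfl | ⟨_, ⟨u, v, hI⟩, -⟩ := h.cases_head
  · rfl
  · have := hw.right_of_append
    exact absurd hI (List.isChain_cons_cons.1 this).1

theorem mem_traceClosure_of_mem {K : Language T} {w : List T}
    (h : w ∈ K) : w ∈ traceClosure I K := ⟨w, h, .refl⟩

theorem mem_traceClosure_of_traceEquiv {K : Language T}
    {v w : List T} (h : TraceEquiv I w v) (hv : v ∈ traceClosure I K) : w ∈ traceClosure I K := by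
  obtain ⟨u, hu, hvu⟩ := hv
  exact ⟨u, hu, h.trans hvu⟩

end Trace

/-! ### Additive weights of words -/

theorem CommDerives.eq_sum_map {V T A : Type} [AddCancelCommMonoid A] {f : List T → A}
    {P : Set (V × T × Multiset V)} {val : V → A} (hf : ∀ u v, f (u ++ v) = f u + f v)
    (hP : ∀ X a α, (X, a, α) ∈ P → f [a] + (α.map val).sum = val X) {M : Multiset V} {w : List T}
    (h : CommDerives P M w) : f w = (M.map val).sum := by
  induction h with
  | nil => simpa using hf [] []
  | @cons X a α M w hX _ ih =>
    calc f (a :: w) = f [a] + f w := hf [a] w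
      _ = f [a] + (α.map val).sum + (M.map val).sum := by
        rw [ih, Multiset.map_add, Multiset.sum_add, add_assoc]
      _ = ((X ::ₘ M).map val).sum := by
        rw [hP X a α hX, Multiset.map_cons, Multiset.sum_cons]

theorem exists_finite_weights {T A ι : Type*} [Add A] [IsCancelAdd A] {f : List T → A}
    (hf : ∀ u v, f (u ++ v) = f u + f v) {F : Set ι} (hF : F.Finite) (L : ι → Language T) :
    ∃ S : Set A, S.Finite ∧ ∀ i ∈ F, ∀ p q c, (∀ w ∈ L i, f (p ++ w ++ q) = c) →
      ∀ w ∈ L i, f w ∈ S := by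
  refine ⟨⋃ i ∈ F, {x | (f '' L i).Subsingleton ∧ x ∈ f '' L i}, hF.biUnion fun i _ => ?_,
    fun i hi p q c hL w hw => Set.mem_biUnion hi ⟨?_, w, hw, rfl⟩⟩
  · exact Set.Subsingleton.finite fun x hx y hy => hx.1 hx.2 hy.2
  · rintro _ ⟨u, hu, rfl⟩ _ ⟨v, hv, rfl⟩
    have huv := (hL u hu).trans (hL v hv).symm
    simpa only [hf, add_left_inj, add_right_inj] using huv

/-! ### Partially-commutative context-free grammars -/

theorem Derives.trans {T C : Type} {step : C → List T → C → Prop} {c d e : C} {u v : List T}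
    (h : Derives step c u d) (h' : Derives step d v e) : Derives step c (u ++ v) e := by
  induction h with
  | nil => exact h'
  | cons h _ ih => exact List.append_assoc .. ▸ .cons h (ih h')

namespace PCGrammar

variable {T : Type} {G : PCGrammar T}

variable (G) in
/-- The productions of the non-terminals in `S`, with their right-hand sides read up to
commutativity. -/
def commRules (S : Set G.NT) : Set (G.NT × T × Multiset G.NT) :=
  {p | p.1 ∈ S ∧ ∃ α : List G.NT, (p.1, p.2.1, α) ∈ G.productions ∧ p.2.2 = α}

theorem derives_of_traceEquiv {α β : List G.NT} (h : TraceEquiv G.Indep α β) :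
    Derives G.Step α [] β := by
  induction h with
  | refl => exact .nil _
  | tail _ h ih =>
    obtain ⟨p, q, hI⟩ := h
    exact ih.trans (.cons (Step.swap p q hI) (.nil _))

variable {S : Set G.NT} {α : List G.NT} {w : List T}

theorem commDerives_of_derives
    (hP : ∀ X a β, X ∈ S → (X, a, β) ∈ G.productions → ∀ Y ∈ β, Y ∈ S)
    (h : Derives G.Step α w []) (hα : ∀ X ∈ α, X ∈ S) : CommDerives (G.commRules S) α w := by
  generalize hε : ([] : List G.NT) = ε at h
  induction h with
  | nil => exact hε ▸ .nil
  | cons hstep _ ih =>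
    cases hstep with
    | @production X a γ β hX =>
      rw [List.forall_mem_cons] at hα
      have hγ : (X, a, ↑γ) ∈ G.commRules S := ⟨hα.1, γ, hX, rfl⟩
      have hγβ := ih (List.forall_mem_append.2 ⟨hP X a γ hα.1 hX, hα.2⟩) hε
      exact CommDerives.cons hγ (Multiset.coe_add γ β ▸ hγβ)
    | swap γ δ hXY =>
      have hperm := TraceEquiv.perm (.single (.swap γ δ hXY))
      exact Multiset.coe_eq_coe.2 hperm ▸ ih (fun Z hZ => hα Z (hperm.mem_iff.2 hZ)) hε

theorem derives_of_commDerives (hS : S.Pairwise G.Indep)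
    (hP : ∀ X a β, X ∈ S → (X, a, β) ∈ G.productions → ∀ Y ∈ β, Y ∈ S)
    (h : CommDerives (G.commRules S) α w) (hα : ∀ X ∈ α, X ∈ S) : Derives G.Step α w [] := by
  generalize hM : (α : Multiset G.NT) = M at h
  induction h generalizing α with
  | nil => exact (Multiset.coe_eq_zero α).1 hM ▸ .nil _
  | @cons X a _ M w hX _ ih =>
    obtain ⟨hXS, γ, hγ, rfl⟩ := hX
    obtain ⟨β, rfl⟩ := Quotient.exists_rep M
    have hperm : α.Perm (X :: β) := Multiset.coe_eq_coe.1 hM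
    have hβ : ∀ Y ∈ β, Y ∈ S := fun Y hY => hα Y (hperm.mem_iff.2 (List.mem_cons_of_mem X hY))
    exact (derives_of_traceEquiv (traceEquiv_of_perm (hS.mono hα) hperm)).trans
      (.cons (Step.production β hγ)
        (ih (List.forall_mem_append.2 ⟨hP X a γ hXS hγ, hβ⟩) (Multiset.coe_add γ β).symm))

theorem derives_iff_commDerives (hS : S.Pairwise G.Indep)
    (hP : ∀ X a β, X ∈ S → (X, a, β) ∈ G.productions → ∀ Y ∈ β, Y ∈ S) (hα : ∀ X ∈ α, X ∈ S) :
    Derives G.Step α w [] ↔ CommDerives (G.commRules S) α w :=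
  ⟨fun h => commDerives_of_derives hP h hα, fun h => derives_of_commDerives hS hP h hα⟩

/-- The partially-commutative grammar in which any two distinct non-terminals are independent,
with the given multisets of non-terminals listed in an arbitrary order. -/
noncomputable def ofComm {V : Type} [hV : Finite V] {P : Set (V × T × Multiset V)} (hP : P.Finite)
    (X : V) : PCGrammar T where
  NT := V
  finite_NT := hV
  initial := X
  productions := (fun p => (p.1, p.2.1, p.2.2.toList)) '' P
  finite_productions := hP.image _
  Indep := (· ≠ ·)
  indep_symm _ _ := Ne.symm
  indep_irrefl _ h := h rfl

theorem commRules_ofComm {V : Type} [Finite V] {P : Set (V × T × Multiset V)} (hP : P.Finite)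
    (X : V) : (ofComm hP X).commRules Set.univ = P := by
  ext ⟨Y, a, α⟩
  constructor
  · rintro ⟨-, _, ⟨p, hp, ⟨⟩⟩, rfl⟩
    exact (congrArg (fun α => (p.1, p.2.1, α) ∈ P) (Multiset.coe_toList p.2.2)).mpr hp
  · exact fun h => ⟨trivial, _, ⟨_, h, rfl⟩, (Multiset.coe_toList α).symm⟩

end PCGrammar

theorem commLanguage_mem_trPCCFL {V T : Type} [Finite V] {P : Set (V × T × Multiset V)}
    (hP : P.Finite) (X : V) : commLanguage P X ∈ TrPCCFL T := by
  refine ⟨.ofComm hP X, fun Y Z W hYZ hZW => ?_, Language.ext fun w => ?_⟩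
  · exact not_not.2 ((not_not.1 hYZ).trans (not_not.1 hZW))
  · refine (PCGrammar.derives_iff_commDerives (S := Set.univ) (fun Y _ Z _ hYZ => hYZ)
      (fun _ _ _ _ _ _ _ => trivial) (fun _ _ => trivial)).trans ?_
    rw [PCGrammar.commRules_ofComm]
    rfl

/-! ### Terms and grammars of process algebra -/

namespace PATerm

variable {V : Type}

/-- The non-terminals of a term, with multiplicity. -/
def vars : PATerm V → Multiset V
  | empty => 0
  | var X => {X}
  | seq t u | par t u => t.vars + u.vars

/-- The parallel composition of a list of non-terminals. -/
def parList : List V → PATerm V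
  | [] => empty
  | X :: α => par (var X) (parList α)

theorem vars_parList (α : List V) : (parList α).vars = α := by
  induction α with
  | nil => rfl
  | cons X α ih => rw [parList, vars, vars, ih, Multiset.singleton_add, Multiset.cons_coe]

theorem parList_append (α β : List V) :
    StructEquiv (parList (α ++ β)) (par (parList α) (parList β)) := by
  induction α with
  | nil => exact (StructEquiv.empty_par _).symm
  | cons X α ih => exact (StructEquiv.par_congr (.refl _) ih).trans (StructEquiv.par_assoc ..).symm

theorem structEquiv_parList_of_perm {α β : List V} (h : α.Perm β) :
    StructEquiv (parList α) (parList β) := by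
  induction h with
  | nil => exact .refl _
  | cons X _ ih => exact .par_congr (.refl _) ih
  | swap X Y α =>
    exact (StructEquiv.par_assoc ..).symm.trans
      ((StructEquiv.par_congr (.par_comm ..) (.refl _)).trans (.par_assoc ..))
  | trans _ _ ih₁ ih₂ => exact ih₁.trans ih₂

end PATerm

namespace PAGrammar

variable {T : Type} (G : PAGrammar T)

/-- `Yields t w`: the word `w` can be read along steps from `t` to the empty term. It is defined by
recursion on `t`, so that a derivation splits along the composition operators. -/
inductive Yields : PATerm G.NT → List T → Prop
  | empty : Yields .empty []
  | var {X : G.NT} {a : T} {t : PATerm G.NT} {w : List T} :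
      (X, a, t) ∈ G.productions → Yields t w → Yields (.var X) (a :: w)
  | seq {t u : PATerm G.NT} {v w : List T} : Yields t v → Yields u w → Yields (.seq t u) (v ++ w)
  | par {t u : PATerm G.NT} {v w x : List T} :
      Yields t v → Yields u w → Interleaving v w x → Yields (.par t u) x

variable {G}

theorem yields_empty_iff {w : List T} : G.Yields .empty w ↔ w = [] :=
  ⟨fun h => by cases h; rfl, fun h => h ▸ .empty⟩

theorem yields_seq_iff {t u : PATerm G.NT} {x : List T} :
    G.Yields (.seq t u) x ↔ ∃ v w, G.Yields t v ∧ G.Yields u w ∧ v ++ w = x := by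
  constructor
  · rintro (_ | _ | ⟨h₁, h₂⟩)
    exact ⟨_, _, h₁, h₂, rfl⟩
  · rintro ⟨v, w, h₁, h₂, rfl⟩
    exact .seq h₁ h₂

theorem yields_par_iff {t u : PATerm G.NT} {x : List T} :
    G.Yields (.par t u) x ↔ ∃ v w, G.Yields t v ∧ G.Yields u w ∧ Interleaving v w x := by
  constructor
  · rintro (_ | _ | _ | ⟨h₁, h₂, h₃⟩)
    exact ⟨_, _, h₁, h₂, h₃⟩
  · rintro ⟨v, w, h₁, h₂, h₃⟩
    exact .par h₁ h₂ h₃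

theorem Yields.par_symm {t u : PATerm G.NT} {x : List T} (h : G.Yields (.par t u) x) :
    G.Yields (.par u t) x := by
  obtain ⟨v, w, h₁, h₂, h₃⟩ := yields_par_iff.1 h
  exact .par h₂ h₁ h₃.symm

theorem Yields.par_assoc {t u v : PATerm G.NT} {x : List T} (h : G.Yields (.par (.par t u) v) x) :
    G.Yields (.par t (.par u v)) x := by
  obtain ⟨_, _, h₁, h₂, h₃⟩ := yields_par_iff.1 h
  obtain ⟨_, _, h₄, h₅, h₆⟩ := yields_par_iff.1 h₁
  obtain ⟨_, h₇, h₈⟩ := h₃.assoc h₆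
  exact .par h₄ (.par h₅ h₂ h₇) h₈

theorem yields_congr {t u : PATerm G.NT} (h : StructEquiv t u) (w : List T) :
    G.Yields t w ↔ G.Yields u w := by
  induction h generalizing w with
  | refl t => rfl
  | symm _ ih => exact (ih w).symm
  | trans _ _ ih₁ ih₂ => exact (ih₁ w).trans (ih₂ w)
  | seq_congr _ _ ih₁ ih₂ => simp only [yields_seq_iff, ih₁, ih₂]
  | par_congr _ _ ih₁ ih₂ => simp only [yields_par_iff, ih₁, ih₂]
  | seq_assoc t u v =>
    simp only [yields_seq_iff]
    constructor
    · rintro ⟨_, w₃, ⟨w₁, w₂, h₁, h₂, rfl⟩, h₃, rfl⟩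
      exact ⟨w₁, _, h₁, ⟨w₂, w₃, h₂, h₃, rfl⟩, (List.append_assoc ..).symm⟩
    · rintro ⟨w₁, _, h₁, ⟨w₂, w₃, h₂, h₃, rfl⟩, rfl⟩
      exact ⟨_, w₃, ⟨w₁, w₂, h₁, h₂, rfl⟩, h₃, List.append_assoc ..⟩
  | par_assoc t u v =>
    exact ⟨Yields.par_assoc, fun h => h.par_symm.par_assoc.par_symm.par_assoc.par_symm⟩
  | par_comm t u => exact ⟨Yields.par_symm, Yields.par_symm⟩
  | empty_seq t => simp [yields_seq_iff, yields_empty_iff]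
  | seq_empty t => simp [yields_seq_iff, yields_empty_iff]
  | empty_par t =>
    refine ⟨fun h => ?_, fun h => .par .empty h (Interleaving.nil_left_iff.2 rfl)⟩
    obtain ⟨_, _, h₁, h₂, h₃⟩ := yields_par_iff.1 h
    cases yields_empty_iff.1 h₁
    exact Interleaving.nil_left_iff.1 h₃ ▸ h₂
  | par_empty t =>
    refine ⟨fun h => ?_, fun h => .par h .empty (Interleaving.nil_right_iff.2 rfl)⟩
    obtain ⟨_, _, h₁, h₂, h₃⟩ := yields_par_iff.1 h
    cases yields_empty_iff.1 h₂
    exact Interleaving.nil_right_iff.1 h₃ ▸ h₁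

theorem Step.yields_cons {t t' : PATerm G.NT} {a : T} (h : G.Step t a t') {w : List T}
    (hw : G.Yields t' w) : G.Yields t (a :: w) := by
  induction h generalizing w with
  | production h => exact .var h hw
  | seq u _ ih =>
    obtain ⟨_, _, h₁, h₂, rfl⟩ := yields_seq_iff.1 hw
    exact .seq (ih h₁) h₂
  | par_left u _ ih =>
    obtain ⟨_, _, h₁, h₂, h₃⟩ := yields_par_iff.1 hw
    exact .par (ih h₁) h₂ (.left _ h₃)
  | par_right t _ ih =>
    obtain ⟨_, _, h₁, h₂, h₃⟩ := yields_par_iff.1 hw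
    exact .par h₁ (ih h₂) (.right _ h₃)
  | struct h₁ _ h₂ ih => exact (yields_congr h₁ _).2 (ih ((yields_congr h₂ _).2 hw))

theorem Yields.structEquiv_empty {t : PATerm G.NT} {w : List T} (h : G.Yields t w) (hw : w = []) :
    StructEquiv t .empty := by
  induction h with
  | empty => exact .refl _
  | var _ _ _ => cases hw
  | seq _ _ ih₁ ih₂ =>
    obtain ⟨h₁, h₂⟩ := List.append_eq_nil_iff.1 hw
    exact (StructEquiv.seq_congr (ih₁ h₁) (ih₂ h₂)).trans (.empty_seq _)
  | par _ _ h ih₁ ih₂ =>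
    subst hw
    cases h
    exact (StructEquiv.par_congr (ih₁ rfl) (ih₂ rfl)).trans (.empty_par _)

theorem Yields.exists_step {t : PATerm G.NT} {a : T} {x w : List T} (h : G.Yields t x)
    (hx : x = a :: w) : ∃ t', G.Step t a t' ∧ G.Yields t' w := by
  induction h generalizing w with
  | empty => cases hx
  | var h₁ h₂ _ => cases hx; exact ⟨_, .production h₁, h₂⟩
  | @seq t u v v' h₁ h₂ ih₁ ih₂ =>
    cases v with
    | nil =>
      obtain ⟨u', h₃, h₄⟩ := ih₂ hx
      exact ⟨u', .struct ((StructEquiv.seq_congr (h₁.structEquiv_empty rfl) (.refl u)).trans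
        (.empty_seq u)) h₃ (.refl u'), h₄⟩
    | cons b v =>
      cases hx
      obtain ⟨t', h₃, h₄⟩ := ih₁ rfl
      exact ⟨_, .seq u h₃, .seq h₄ h₂⟩
  | @par t u _ _ _ h₁ h₂ h ih₁ ih₂ =>
    subst hx
    cases h with
    | left _ h =>
      obtain ⟨t', h₃, h₄⟩ := ih₁ rfl
      exact ⟨_, .par_left u h₃, .par h₄ h₂ h⟩
    | right _ h =>
      obtain ⟨u', h₃, h₄⟩ := ih₂ rfl
      exact ⟨_, .par_right t h₃, .par h₁ h₄ h⟩

theorem Yields.derives {t : PATerm G.NT} {w : List T} (h : G.Yields t w) (hw : w ≠ []) :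
    Derives (fun t u t' => ∃ a, u = [a] ∧ G.Step t a t') t w .empty := by
  induction w generalizing t with
  | nil => exact absurd rfl hw
  | cons a w ih =>
    obtain ⟨t', h₁, h₂⟩ := h.exists_step rfl
    cases w with
    | nil =>
      exact .cons (u := [a]) ⟨a, rfl, .struct (.refl t) h₁ (h₂.structEquiv_empty rfl)⟩ (.nil _)
    | cons b w => exact .cons (u := [a]) ⟨a, rfl, h₁⟩ (ih h₂ (List.cons_ne_nil b w))

theorem yields_of_derives {t t' : PATerm G.NT} {w : List T}
    (h : Derives (fun t u t' => ∃ a, u = [a] ∧ G.Step t a t') t w t') (ht : t' = .empty) :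
    G.Yields t w := by
  induction h with
  | nil c => exact ht ▸ .empty
  | cons h _ ih =>
    obtain ⟨a, rfl, h⟩ := h
    exact h.yields_cons (ih ht)

theorem mem_language_iff {w : List T} : w ∈ G.language ↔ G.Yields (.var G.initial) w := by
  refine ⟨fun h => yields_of_derives h rfl, fun h => h.derives ?_⟩
  cases h
  exact List.cons_ne_nil _ _

variable (G) in
/-- The productions, with the terms replaced by the multisets of their non-terminals. -/
def commRules : Set (G.NT × T × Multiset G.NT) :=
  {p | ∃ t, (p.1, p.2.1, t) ∈ G.productions ∧ p.2.2 = t.vars}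

theorem Yields.commDerives {t : PATerm G.NT} {w : List T} (h : G.Yields t w) :
    CommDerives G.commRules t.vars w := by
  induction h with
  | empty => exact .nil
  | @var X a t w hX _ ih =>
    have hX : (X, a, t.vars) ∈ G.commRules := ⟨t, hX, rfl⟩
    exact CommDerives.cons hX ((add_zero t.vars).symm ▸ ih)
  | seq _ _ ih₁ ih₂ => exact ih₁.interleave ih₂ (.append ..)
  | par _ _ h ih₁ ih₂ => exact ih₁.interleave ih₂ h

theorem yields_parList_of_commDerives
    (hG : ∀ X a t, (X, a, t) ∈ G.productions → ∃ α, t = PATerm.parList α) {α : List G.NT}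
    {w : List T} (h : CommDerives G.commRules α w) : G.Yields (.parList α) w := by
  generalize hM : (α : Multiset G.NT) = M at h
  induction h generalizing α with
  | nil => exact (Multiset.coe_eq_zero α).1 hM ▸ .empty
  | @cons X a _ M w hX _ ih =>
    obtain ⟨t, ht, rfl⟩ := hX
    obtain ⟨γ, rfl⟩ := hG X a t ht
    obtain ⟨β, rfl⟩ := Quotient.exists_rep M
    have hperm : α.Perm (X :: β) := Multiset.coe_eq_coe.1 hM
    have hγβ : G.Yields (.parList (γ ++ β)) w := ih (by rw [PATerm.vars_parList]; rfl)
    obtain ⟨u, v, hu, hv, huv⟩ :=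
      yields_par_iff.1 ((yields_congr (PATerm.parList_append γ β) w).1 hγβ)
    exact (yields_congr (PATerm.structEquiv_parList_of_perm hperm) _).2
      (.par (.var ht hu) hv (.left a huv))

theorem yields_var_iff_commDerives
    (hG : ∀ X a t, (X, a, t) ∈ G.productions → ∃ α, t = PATerm.parList α) {X : G.NT}
    {w : List T} : G.Yields (.var X) w ↔ CommDerives G.commRules {X} w :=
  ⟨Yields.commDerives, fun h => (yields_congr (.par_empty _) w).1
    (yields_parList_of_commDerives hG (α := [X]) h)⟩

/-- The process-algebra grammar whose productions have parallel compositions of non-terminals on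
the right-hand side, with the given multisets listed in an arbitrary order. -/
noncomputable def ofComm {V : Type} [hV : Finite V] {P : Set (V × T × Multiset V)} (hP : P.Finite)
    (X : V) : PAGrammar T where
  NT := V
  finite_NT := hV
  initial := X
  productions := (fun p => (p.1, p.2.1, .parList p.2.2.toList)) '' P
  finite_productions := hP.image _

theorem commRules_ofComm {V : Type} [Finite V] {P : Set (V × T × Multiset V)} (hP : P.Finite)
    (X : V) : (ofComm hP X).commRules = P := by
  ext ⟨Y, a, α⟩
  have hvars (p : V × T × Multiset V) : (PATerm.parList p.2.2.toList).vars = p.2.2 :=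
    (PATerm.vars_parList _).trans (Multiset.coe_toList _)
  constructor
  · rintro ⟨_, ⟨p, hp, ⟨⟩⟩, rfl⟩
    exact (congrArg (fun α => (p.1, p.2.1, α) ∈ P) (hvars p)).mpr hp
  · exact fun h => ⟨_, ⟨_, h, rfl⟩, (hvars _).symm⟩

end PAGrammar

theorem commLanguage_mem_shuffleCFL {V T : Type} [Finite V] {P : Set (V × T × Multiset V)}
    (hP : P.Finite) (X : V) : commLanguage P X ∈ ShuffleCFL T := by
  refine ⟨.ofComm hP X, Language.ext fun w => PAGrammar.mem_language_iff.trans ?_⟩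
  refine (PAGrammar.yields_var_iff_commDerives ?_).trans ?_
  · rintro _ _ _ ⟨p, -, ⟨⟩⟩
    exact ⟨_, rfl⟩
  · rw [PAGrammar.commRules_ofComm]
    rfl

/-! ### Balanced words over `{a, b, c, s}` -/

theorem length_eq_count_add (w : List Letter) :
    w.length = w.count .a + w.count .b + w.count .c + w.count .s := by
  induction w with
  | nil => rfl
  | cons x w ih => cases x <;> simp [ih] <;> omega

theorem isInfix_of_mem_of_mem {T : Type} {p v q x y z : List T} {l r : T}
    (h : p ++ v ++ q = x ++ y ++ z) (hl : l ∈ v) (hl' : l ∉ y ++ z) (hr : r ∈ v)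
    (hr' : r ∉ x ++ y) : y <:+: v := by
  rw [List.append_assoc, List.append_assoc] at h
  obtain ⟨x', rfl, hv⟩ | ⟨p', -, h⟩ := List.append_eq_append_iff.1 h
  · rw [← List.append_assoc x'] at hv
    obtain ⟨t, ht, -⟩ | ⟨z', rfl, -⟩ := List.append_eq_append_iff.1 hv
    · have hr : r ∈ x' ++ y := ht ▸ List.mem_append_left t hr
      exact absurd (List.append_assoc p x' y ▸ List.mem_append_right p hr) hr'
    · exact ⟨x', z', rfl⟩
  · exact absurd (h ▸ List.mem_append_right p' (List.mem_append_left q hl)) hl'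

/-- The differences `(#a - #b, #b - #c)` of numbers of occurrences in a word. -/
def imbalance (w : List Letter) : ℤ × ℤ := (w.count .a - w.count .b, w.count .b - w.count .c)

theorem imbalance_append (u v : List Letter) :
    imbalance (u ++ v) = imbalance u + imbalance v := by
  ext <;> simp only [imbalance, List.count_append, Nat.cast_add, Prod.fst_add, Prod.snd_add] <;>
    ring

/-- The numbers of occurrences of `a` and `b` differ by at most `D`, and so do those of
`b` and `c`. -/
def NearlyBalanced (D : ℕ) (w : List Letter) : Prop :=
  (imbalance w).1.natAbs ≤ D ∧ (imbalance w).2.natAbs ≤ D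

theorem exists_nearlyBalanced {ι : Type} {F : Set ι} (hF : F.Finite) (L : ι → Language Letter) :
    ∃ D, ∀ i ∈ F, ∀ p q, (∀ w ∈ L i, imbalance (p ++ w ++ q) = 0) →
      ∀ w ∈ L i, NearlyBalanced D w := by
  obtain ⟨S, hS, hL⟩ := exists_finite_weights imbalance_append hF L
  obtain ⟨D, hD⟩ := (hS.image fun x => max x.1.natAbs x.2.natAbs).bddAbove
  exact ⟨D, fun i hi p q h w hw =>
    max_le_iff.1 (hD (Set.mem_image_of_mem _ (hL i hi p q 0 h w hw)))⟩

/-- The word `aⁿ bⁿ cⁿ`. -/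
def abcPow (n : ℕ) : List Letter := replicate n .a ++ replicate n .b ++ replicate n .c

/-! ### Context-free grammars -/

section ContextFree

variable {T : Type}

/-- `CFYields g α w`: the word `w` is derivable from the string of symbols `α`. It is defined by
recursion on `α`, so that a derivation splits along suffixes of right-hand sides. -/
inductive CFYields (g : ContextFreeGrammar T) : List (Symbol T g.NT) → List T → Prop
  | nil : CFYields g [] []
  | terminal (x : T) {α : List (Symbol T g.NT)} {w : List T} :
      CFYields g α w → CFYields g (.terminal x :: α) (x :: w)
  | nonterminal {r : ContextFreeRule T g.NT} {α : List (Symbol T g.NT)} {v w : List T} :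
      r ∈ g.rules → CFYields g r.output v → CFYields g α w →
        CFYields g (.nonterminal r.input :: α) (v ++ w)

variable {g : ContextFreeGrammar T}

theorem CFYields.exists_of_append {α β : List (Symbol T g.NT)} {x : List T}
    (h : CFYields g (α ++ β) x) :
    ∃ v w, CFYields g α v ∧ CFYields g β w ∧ x = v ++ w := by
  generalize hγ : α ++ β = γ at h
  induction h generalizing α with
  | nil =>
    obtain ⟨rfl, rfl⟩ := List.append_eq_nil_iff.1 hγ
    exact ⟨[], [], .nil, .nil, rfl⟩
  | terminal x h ih =>
    cases α with
    | nil => cases hγ; exact ⟨[], _, .nil, .terminal x h, rfl⟩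
    | cons y α =>
      obtain ⟨rfl, hγ'⟩ := List.cons_eq_cons.1 hγ
      obtain ⟨v, w, h₁, h₂, rfl⟩ := ih hγ'
      exact ⟨x :: v, w, .terminal x h₁, h₂, rfl⟩
  | nonterminal hr hv h _ ih =>
    cases α with
    | nil => cases hγ; exact ⟨[], _, .nil, .nonterminal hr hv h, rfl⟩
    | cons y α =>
      obtain ⟨rfl, hγ'⟩ := List.cons_eq_cons.1 hγ
      obtain ⟨v, w, h₁, h₂, rfl⟩ := ih hγ'
      exact ⟨_, w, .nonterminal hr hv h₁, h₂, (List.append_assoc ..).symm⟩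

theorem cfYields_map_terminal (w : List T) : CFYields g (w.map .terminal) w := by
  induction w with
  | nil => exact .nil
  | cons x w ih => exact .terminal x ih

theorem CFYields.of_produces {α β : List (Symbol T g.NT)} (h : g.Produces α β) {w : List T}
    (hw : CFYields g β w) : CFYields g α w := by
  obtain ⟨r, hr, h⟩ := h
  induction h generalizing w with
  | head α =>
    obtain ⟨v, w, h₁, h₂, rfl⟩ := hw.exists_of_append
    exact .nonterminal hr h₁ h₂
  | cons x _ ih =>
    cases hw with
    | terminal x hw => exact .terminal x (ih hw)
    | nonterminal hr' hv hw => exact .nonterminal hr' hv (ih hw)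

theorem CFYields.derives {α : List (Symbol T g.NT)} {w : List T} (h : CFYields g α w) :
    g.Derives α (w.map .terminal) := by
  induction h with
  | nil => rfl
  | terminal x _ ih => exact ih.append_left [.terminal x]
  | @nonterminal r α v w hr _ _ ih₁ ih₂ =>
    rw [List.map_append]
    exact (ContextFreeGrammar.Produces.trans_derives ⟨r, hr, .head α⟩ (ih₁.append_right α)).trans
      (ih₂.append_left _)

theorem mem_language_iff_cfYields {w : List T} :
    w ∈ g.language ↔ CFYields g [.nonterminal g.initial] w := by
  refine ⟨fun h => ?_, CFYields.derives⟩
  rw [ContextFreeGrammar.mem_language_iff] at h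
  generalize [Symbol.nonterminal g.initial] = α at h ⊢
  induction h using Relation.ReflTransGen.head_induction_on with
  | refl => exact cfYields_map_terminal w
  | head h _ ih => exact .of_produces h ih

/-- The suffixes of right-hand sides of productions and of the initial string: the strings to which
`CFYields` recurs from the initial one. -/
def cfSuffixes (g : ContextFreeGrammar T) : Set (List (Symbol T g.NT)) :=
  {α | α <:+ [.nonterminal g.initial]} ∪ ⋃ r ∈ g.rules, {α | α <:+ r.output}

theorem finite_cfSuffixes (g : ContextFreeGrammar T) : (cfSuffixes g).Finite := by
  have finite_suffixes (β : List (Symbol T g.NT)) : {α | α <:+ β}.Finite := by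
    simpa only [← List.mem_tails] using β.tails.finite_toSet
  exact (finite_suffixes _).union
    (g.rules.finite_toSet.biUnion fun r _ => finite_suffixes r.output)

theorem mem_cfSuffixes_of_isSuffix {α β : List (Symbol T g.NT)} (h : α <:+ β)
    (hβ : β ∈ cfSuffixes g) : α ∈ cfSuffixes g := by
  simp only [cfSuffixes, Set.mem_union, Set.mem_iUnion, Set.mem_ofPred_eq] at hβ ⊢
  exact hβ.imp h.trans fun ⟨r, hr, hβr⟩ => ⟨r, hr, h.trans hβr⟩

theorem CFYields.exists_factor {α : List (Symbol T g.NT)} {w : List T} (h : CFYields g α w)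
    (hα : α ∈ cfSuffixes g) {m : ℕ} (hm : 0 < m) (hw : m ≤ w.length) :
    ∃ β ∈ cfSuffixes g, ∃ p v q, w = p ++ v ++ q ∧ CFYields g β v ∧
      (∀ v', CFYields g β v' → CFYields g α (p ++ v' ++ q)) ∧ m ≤ v.length ∧ v.length < 2 * m := by
  by_cases hlt : w.length < 2 * m
  · exact ⟨α, hα, [], w, [], by simp, h, by simp, hw, hlt⟩
  match h with
  | .nil => grind
  | .terminal x h =>
    obtain ⟨β, hβ, p, v, q, rfl, hv, hctx, hlen⟩ :=
      h.exists_factor (mem_cfSuffixes_of_isSuffix (List.suffix_cons ..) hα) hm (by grind)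
    exact ⟨β, hβ, x :: p, v, q, rfl, hv, fun v' hv' => .terminal x (hctx v' hv'), hlen⟩
  | .nonterminal (v := u) (w := w) hr h₁ h₂ =>
    rcases le_or_gt m w.length with hw' | hw'
    · obtain ⟨β, hβ, p, v, q, rfl, hv, hctx, hlen⟩ :=
        h₂.exists_factor (mem_cfSuffixes_of_isSuffix (List.suffix_cons ..) hα) hm hw'
      refine ⟨β, hβ, u ++ p, v, q, by simp only [List.append_assoc], hv, fun v' hv' => ?_, hlen⟩
      have hw := CFYields.nonterminal hr h₁ (hctx v' hv')
      simpa only [List.append_assoc] using hw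
    · obtain ⟨β, hβ, p, v, q, rfl, hv, hctx, hlen⟩ :=
        h₁.exists_factor (.inr (Set.mem_biUnion hr List.suffix_rfl)) hm (by grind)
      refine ⟨β, hβ, p, v, q ++ w, by simp only [List.append_assoc], hv, fun v' hv' => ?_, hlen⟩
      have hw := CFYields.nonterminal hr (hctx v' hv') h₂
      simpa only [List.append_assoc] using hw

theorem CFYields.append {α β : List (Symbol T g.NT)} {v w : List T} (hα : CFYields g α v)
    (hβ : CFYields g β w) : CFYields g (α ++ β) (v ++ w) := by
  induction hα with
  | nil => exact hβ
  | terminal x _ ih => exact .terminal x ih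
  | nonterminal hr h _ _ ih => exact List.append_assoc _ _ w ▸ .nonterminal hr h ih

/-- The language of a symbol, given the languages of the non-terminals. -/
def symbolLanguage {N : Type} (L : N → Language T) : Symbol T N → Language T
  | .terminal x => {[x]}
  | .nonterminal A => L A

theorem CFYields.mem_prod {L : g.NT → Language T}
    (hL : ∀ r ∈ g.rules, (r.output.map (symbolLanguage L)).prod ≤ L r.input)
    {α : List (Symbol T g.NT)} {w : List T} (h : CFYields g α w) :
    w ∈ (α.map (symbolLanguage L)).prod := by
  induction h with
  | nil => exact Language.nil_mem_one
  | terminal x _ ih => exact Language.append_mem_mul (Set.mem_singleton [x]) ih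
  | nonterminal hr _ _ ih₁ ih₂ => exact Language.append_mem_mul (hL _ hr ih₁) ih₂

theorem prod_map_symbolLanguage_terminal {N : Type} (L : N → Language T) (w : List T) :
    ((w.map .terminal).map (symbolLanguage L)).prod = {w} := by
  induction w with
  | nil => rfl
  | cons x w ih =>
    rw [List.map_cons, List.map_cons, List.prod_cons, ih]
    exact Set.image2_singleton

theorem isContextFree_replicate_mid_replicate (u m v : List T) :
    Language.IsContextFree
      {w | ∃ n, w = (replicate n u).flatten ++ m ++ (replicate n v).flatten} := by
  classical
  let wrap : ContextFreeRule T Unit :=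
    ⟨(), u.map .terminal ++ [.nonterminal ()] ++ v.map .terminal⟩
  let base : ContextFreeRule T Unit := ⟨(), m.map .terminal⟩
  let g : ContextFreeGrammar T := ⟨Unit, (), {wrap, base}⟩
  let L : Language T := {w | ∃ n, w = (replicate n u).flatten ++ m ++ (replicate n v).flatten}
  refine ⟨g, Language.ext fun w => mem_language_iff_cfYields.trans ⟨fun h => ?_, ?_⟩⟩
  · have hL : ∀ r ∈ g.rules, (r.output.map (symbolLanguage fun _ => L)).prod ≤ L := by
      intro r hr
      obtain rfl | rfl : r = wrap ∨ r = base := by simpa [g] using hr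
      · simp only [wrap, List.map_append, List.prod_append, prod_map_symbolLanguage_terminal]
        rintro _ ⟨_, ⟨_, rfl, _, ⟨_, ⟨n, rfl⟩, _, rfl, rfl⟩, rfl⟩, _, rfl, rfl⟩
        refine ⟨n + 1, ?_⟩
        rw [List.replicate_succ, List.replicate_succ']
        simp
      · simp only [base, prod_map_symbolLanguage_terminal]
        rintro _ rfl
        exact ⟨0, by simp⟩
    have h : w ∈ L * 1 := h.mem_prod (L := fun _ => L) hL
    rwa [mul_one] at h
  · rintro ⟨n, rfl⟩
    induction n with
    | zero =>
      have h := CFYields.nonterminal (g := g) (r := base) (by simp [g])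
        (cfYields_map_terminal m) .nil
      simpa using h
    | succ n ih =>
      have h := CFYields.nonterminal (g := g) (r := wrap) (by simp [g])
        (((cfYields_map_terminal u).append ih).append (cfYields_map_terminal v)) .nil
      rw [List.replicate_succ, List.replicate_succ']
      simpa using h

end ContextFree

/-! ### A language in trPCCFL and shuffle-CFL but not in trace-CFL -/

/-- The productions `a →ᵃ a ‖ b`, `a →ᵃ b`, `b →ᵇ c` and `c →ᶜ ε`: every `a` read makes one `b`
available, and every `b` read makes one `c` available. -/
def abcRules : Set (Letter × Letter × Multiset Letter) :=
  {(.a, .a, {.a, .b}), (.a, .a, {.b}), (.b, .b, {.c}), (.c, .c, 0)}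

/-- The language generated from `a` by `abcRules`. It contains `aⁿ bⁿ cⁿ` for `n ≥ 1` but neither
`bac` nor `acb`, so that it is not closed under swaps of `a` and `b`, nor of `b` and `c`. -/
def shuffledABC : Language Letter := commLanguage abcRules .a

theorem finite_abcRules : abcRules.Finite := by
  simp [abcRules]

theorem imbalance_eq_zero_of_mem_shuffledABC {w : List Letter} (h : w ∈ shuffledABC) :
    imbalance w = 0 := by
  let val : Letter → ℤ × ℤ
    | .b => (-1, 0)
    | .c => (0, -1)
    | .a | .s => 0
  refine (CommDerives.eq_sum_map (val := val) imbalance_append ?_ h).trans ?_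
  · rintro X x α (h | h | h | h) <;> obtain ⟨rfl, rfl, rfl⟩ := h <;> decide
  · simp [val]

theorem bc_mem_commLanguage_abcRules : [.b, .c] ∈ commLanguage abcRules .b := by
  have hb : (.b, .b, {.c}) ∈ abcRules := by simp [abcRules]
  have hc : (.c, .c, 0) ∈ abcRules := by simp [abcRules]
  exact cons_mem_commLanguage hb (cons_mem_commLanguage hc .nil)

theorem interleaving_abcPow_bc (n : ℕ) :
    Interleaving (abcPow n) [.b, .c] (replicate n .a ++ replicate (n + 1) .b ++
      replicate (n + 1) .c) := by
  have snoc (m : ℕ) (x : Letter) : Interleaving (replicate m x) [x] (replicate (m + 1) x) :=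
    List.replicate_succ' ▸ .append _ _
  exact ((Interleaving.nil_right_iff.2 rfl).append_append (snoc n .b)).append_append (snoc n .c)

theorem abcPow_mem_shuffledABC (n : ℕ) : abcPow (n + 1) ∈ shuffledABC := by
  induction n with
  | zero =>
    have ha : (.a, .a, {.b}) ∈ abcRules := by simp [abcRules]
    exact cons_mem_commLanguage ha bc_mem_commLanguage_abcRules
  | succ n ih =>
    have ha : (.a, .a, {.a, .b}) ∈ abcRules := by simp [abcRules]
    exact cons_mem_commLanguage ha
      (ih.interleave bc_mem_commLanguage_abcRules (interleaving_abcPow_bc (n + 1)))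

theorem bac_notMem_shuffledABC : [.b, .a, .c] ∉ shuffledABC := by
  intro h
  obtain ⟨X, α, N, hX, hP, -⟩ := commDerives_cons_iff.1 h
  obtain ⟨rfl, rfl⟩ := Multiset.singleton_eq_cons_iff _ |>.1 hX
  simp [abcRules] at hP

theorem acb_notMem_shuffledABC : [.a, .c, .b] ∉ shuffledABC := by
  intro h
  obtain ⟨X, α, N, hX, hP, h⟩ := commDerives_cons_iff.1 h
  obtain ⟨rfl, rfl⟩ := Multiset.singleton_eq_cons_iff _ |>.1 hX
  obtain ⟨Y, β, M, hY, hP', -⟩ := commDerives_cons_iff.1 h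
  obtain ⟨rfl, rfl⟩ : Y = .c ∧ β = 0 := by simpa [abcRules] using hP'
  have hc : Letter.c ∈ α + 0 := hY ▸ Multiset.mem_cons_self _ _
  rcases hP with hP | hP | hP | hP <;> obtain ⟨-, -, rfl⟩ := hP <;> simp at hc

theorem exists_abcPow_notMem {K : Language Letter} (hK : K.IsContextFree)
    (hb : ∀ w ∈ K, imbalance w = 0) : ∃ n, abcPow (n + 1) ∉ K := by
  obtain ⟨g, rfl⟩ := hK
  obtain ⟨D, hD⟩ := exists_nearlyBalanced (finite_cfSuffixes g) fun α => {w | CFYields g α w}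
  refine ⟨6 * D + 1, fun h => ?_⟩
  obtain ⟨β, hβ, p, v, q, hvq, hv, hctx, hlen, hlen'⟩ :=
    (mem_language_iff_cfYields.1 h).exists_factor (.inl List.suffix_rfl) (m := 3 * D + 1)
      (by omega) (by simp [abcPow]; omega)
  have hbal : NearlyBalanced D v :=
    hD β hβ p q (fun w hw => hb _ (mem_language_iff_cfYields.2 (hctx w hw))) v hv
  simp only [NearlyBalanced, imbalance] at hbal
  have hs : v.count .s = 0 := by
    refine List.count_eq_zero.2 fun hs => ?_
    have : Letter.s ∈ p ++ v ++ q := by simp [hs]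
    simp [← hvq, abcPow] at this
  rw [length_eq_count_add, hs] at hlen hlen'
  have ha : Letter.a ∈ v := List.count_pos_iff.1 (by omega)
  have hc : Letter.c ∈ v := List.count_pos_iff.1 (by omega)
  have hinfix : replicate (6 * D + 2) .b <:+: v :=
    isInfix_of_mem_of_mem hvq.symm ha (by simp) hc (by simp)
  have hcount := hinfix.sublist.count_le .b
  rw [List.count_replicate_self] at hcount
  omega

theorem isChain_abcPow {R : Letter → Letter → Prop} (hrefl : ∀ x, R x x) (hab : R .a .b)
    (hbc : R .b .c) (n : ℕ) : (abcPow (n + 1)).IsChain R := by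
  have chain (x : Letter) : (replicate (n + 1) x).IsChain R :=
    List.isChain_replicate_of_rel _ (hrefl x)
  simp [abcPow, List.isChain_append, chain, List.getLast?_replicate, List.head?_replicate, hab, hbc]

theorem shuffledABC_mem_trPCCFL : shuffledABC ∈ TrPCCFL Letter :=
  commLanguage_mem_trPCCFL finite_abcRules .a

theorem shuffledABC_mem_shuffleCFL : shuffledABC ∈ ShuffleCFL Letter :=
  commLanguage_mem_shuffleCFL finite_abcRules .a

theorem shuffledABC_notMem_traceCFL : shuffledABC ∉ TraceCFL Letter := by
  rintro ⟨I, hsymm, hirrefl, K, hK, hL⟩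
  have swap_closed {v w : List Letter} (h : LetterSwap I w v) (hv : v ∈ shuffledABC) :
      w ∈ shuffledABC := by
    rw [← hL] at hv ⊢
    exact mem_traceClosure_of_traceEquiv (.single h) hv
  have habc : [.a, .b, .c] ∈ shuffledABC := abcPow_mem_shuffledABC 0
  have hab : ¬ I .a .b := fun h =>
    bac_notMem_shuffledABC (swap_closed (.swap [] [Letter.c] (hsymm _ _ h)) habc)
  have hbc : ¬ I .b .c := fun h =>
    acb_notMem_shuffledABC (swap_closed (.swap [Letter.a] [] (hsymm _ _ h)) habc)
  obtain ⟨n, hn⟩ := exists_abcPow_notMem hK fun w hw =>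
    imbalance_eq_zero_of_mem_shuffledABC (hL ▸ mem_traceClosure_of_mem hw)
  obtain ⟨v, hv, h⟩ : abcPow (n + 1) ∈ traceClosure I K := hL ▸ abcPow_mem_shuffledABC n
  exact hn (eq_of_traceEquiv_of_isChain (isChain_abcPow hirrefl hab hbc n) h ▸ hv)

/-! ### The language L₃ is in trace-CFL and in trPCCFL -/

theorem mem_L₃_iff {w : List Letter} : w ∈ L₃ ↔
    ∃ n v, v.Perm (replicate n .b ++ replicate n .c) ∧ w = replicate n .a ++ .s :: v := by
  simp only [← interleaving_replicate_iff]
  rfl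

theorem flatten_replicate_pair_perm {T : Type} (x y : T) (n : ℕ) :
    (replicate n [x, y]).flatten.Perm (replicate n x ++ replicate n y) := by
  induction n with
  | zero => rfl
  | succ n ih =>
    rw [List.replicate_succ, List.flatten_cons, List.replicate_succ, List.replicate_succ]
    exact .cons x ((ih.cons y).trans List.perm_middle.symm)

/-- The independence relation on letters in which only `b` and `c` commute. -/
def IndepBC (x y : Letter) : Prop := x = .b ∧ y = .c ∨ x = .c ∧ y = .b

theorem traceEquiv_indepBC_iff {n : ℕ} {v : List Letter} :
    TraceEquiv IndepBC v (replicate n [.b, .c]).flatten ↔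
      v.Perm (replicate n .b ++ replicate n .c) := by
  refine ⟨fun h => h.perm.trans (flatten_replicate_pair_perm ..), fun h => ?_⟩
  refine traceEquiv_of_perm ?_ (h.trans (flatten_replicate_pair_perm ..).symm)
  intro x hx y hy hxy
  simp only [Set.mem_ofPred_eq, h.mem_iff, List.mem_append, List.mem_replicate] at hx hy
  unfold IndepBC
  grind

theorem L₃_mem_traceCFL : L₃ ∈ TraceCFL Letter := by
  refine ⟨IndepBC, fun _ _ => ?_, fun x => ?_, _,
    isContextFree_replicate_mid_replicate [.a] [.s] [.b, .c],
    Language.ext fun w => Iff.trans ?_ mem_L₃_iff.symm⟩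
  · unfold IndepBC
    tauto
  · cases x <;> simp [IndepBC]
  have traceEquiv_iff (n : ℕ) := traceEquiv_append_left_iff (w := w)
    (u := (replicate n [.a]).flatten ++ [.s]) (v := (replicate n [.b, .c]).flatten)
    (I := IndepBC) (by simp [IndepBC, or_imp, forall_and])
  constructor
  · rintro ⟨_, ⟨n, rfl⟩, h⟩
    obtain ⟨v, rfl, hv⟩ := (traceEquiv_iff n).1 h
    exact ⟨n, v, traceEquiv_indepBC_iff.1 hv, by simp⟩
  · rintro ⟨n, v, hv, rfl⟩
    exact ⟨_, ⟨n, rfl⟩, (traceEquiv_iff n).2 ⟨v, by simp, traceEquiv_indepBC_iff.2 hv⟩⟩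

/-- The productions of `gramL₃`. -/
def prodsL₃ : Set (Letter × Letter × List Letter) :=
  {(.s, .a, [.s, .a]), (.s, .s, []), (.a, .b, [.c]), (.a, .c, [.b]), (.b, .b, []), (.c, .c, [])}

/-- A partially-commutative grammar of `L₃`. The non-terminal `s` reads `a` as long as it is
present and leaves behind equally many non-terminals `a`, each of which derives `bc` and `cb`; they
cannot overtake `s`, on which they depend. -/
abbrev gramL₃ : PCGrammar Letter where
  NT := Letter
  finite_NT := inferInstance
  initial := .s
  productions := prodsL₃
  finite_productions := by simp [prodsL₃]
  Indep X Y := X ≠ Y ∧ ¬ (X ∈ [.s, .a] ∧ Y ∈ [.s, .a])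
  indep_symm _ _ h := ⟨h.1.symm, fun h' => h.2 h'.symm⟩
  indep_irrefl _ h := h.1 rfl

theorem transitiveDependence_gramL₃ : gramL₃.TransitiveDependence := by
  intro X Y Z hXY hYZ
  simp only [PCGrammar.Dep] at *
  grind

/-- The commutative productions of `gramL₃` for the non-terminals other than `s`. -/
def rulesBC : Set (Letter × Letter × Multiset Letter) := gramL₃.commRules {.s}ᶜ

theorem perm_of_commDerives_rulesBC {k : ℕ} {v : List Letter}
    (h : CommDerives rulesBC (Multiset.replicate k .a) v) :
    v.Perm (replicate k .b ++ replicate k .c) := by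
  let val : Letter → Multiset Letter
    | .a => {.b, .c}
    | .b => {.b}
    | .c => {.c}
    | .s => 0
  have hv : (v : Multiset Letter) = ((Multiset.replicate k .a).map val).sum := by
    refine h.eq_sum_map (fun u v => (Multiset.coe_add u v).symm) ?_
    rintro X x _ ⟨hX, α, hP, rfl⟩
    obtain hP | hP | hP | hP | hP | hP := hP <;> obtain ⟨rfl, rfl, rfl⟩ := hP <;>
      first | exact absurd rfl hX | decide
  rw [← Multiset.coe_eq_coe, hv, Multiset.map_replicate, Multiset.sum_replicate,
    ← Multiset.coe_add, Multiset.coe_replicate, Multiset.coe_replicate]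
  exact (nsmul_add ({.b} : Multiset Letter) {.c} k).trans
    (congrArg₂ _ (Multiset.nsmul_singleton ..) (Multiset.nsmul_singleton ..))

theorem commDerives_rulesBC_pair {x y : Letter} (h : IndepBC x y) :
    CommDerives rulesBC {.a} [x, y] := by
  have mem_rulesBC {X x : Letter} {α : List Letter} (hX : X ≠ .s) (h : (X, x, α) ∈ prodsL₃) :
      (X, x, (α : Multiset Letter)) ∈ rulesBC := ⟨hX, α, h, rfl⟩
  obtain ⟨rfl, rfl⟩ | ⟨rfl, rfl⟩ := h
  · have ha := mem_rulesBC (X := .a) (x := .b) (α := [.c]) (by simp) (by simp [prodsL₃])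
    have hc := mem_rulesBC (X := .c) (x := .c) (α := []) (by simp) (by simp [prodsL₃])
    exact cons_mem_commLanguage ha (cons_mem_commLanguage hc .nil)
  · have ha := mem_rulesBC (X := .a) (x := .c) (α := [.b]) (by simp) (by simp [prodsL₃])
    have hb := mem_rulesBC (X := .b) (x := .b) (α := []) (by simp) (by simp [prodsL₃])
    exact cons_mem_commLanguage ha (cons_mem_commLanguage hb .nil)

theorem exists_append_cons_of_cons_perm {T : Type} {x y : T} {k : ℕ} {v : List T}
    (h : (x :: v).Perm (replicate (k + 1) x ++ replicate (k + 1) y)) :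
    ∃ p q, v = p ++ y :: q ∧ (p ++ q).Perm (replicate k x ++ replicate k y) := by
  have hv : v.Perm (y :: (replicate k x ++ replicate k y)) :=
    (List.perm_cons x).1 h |>.trans List.perm_middle
  obtain ⟨p, q, rfl⟩ := List.append_of_mem (hv.mem_iff.2 List.mem_cons_self)
  exact ⟨p, q, rfl, (List.perm_cons y).1 (List.perm_middle.symm.trans hv)⟩

theorem commDerives_rulesBC_of_perm {k : ℕ} {v : List Letter}
    (h : v.Perm (replicate k .b ++ replicate k .c)) :
    CommDerives rulesBC (Multiset.replicate k .a) v := by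
  induction k generalizing v with
  | zero => exact h.eq_nil ▸ .nil
  | succ k ih =>
    obtain _ | ⟨x, v⟩ := v
    · simp [List.replicate_succ] at h
    suffices ∃ y p q, IndepBC x y ∧ v = p ++ y :: q ∧
        (p ++ q).Perm (replicate k .b ++ replicate k .c) by
      obtain ⟨y, p, q, hxy, rfl, hpq⟩ := this
      rw [Multiset.replicate_succ]
      exact (commDerives_rulesBC_pair hxy).interleave (ih hpq) (.pair_cons_append_cons x y p q)
    have hx : x = .b ∨ x = .c := by simpa using h.subset List.mem_cons_self
    obtain rfl | rfl := hx
    · obtain ⟨p, q, rfl, hpq⟩ := exists_append_cons_of_cons_perm h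
      exact ⟨.c, p, q, .inl ⟨rfl, rfl⟩, rfl, hpq⟩
    · obtain ⟨p, q, rfl, hpq⟩ := exists_append_cons_of_cons_perm (h.trans List.perm_append_comm)
      exact ⟨.b, p, q, .inr ⟨rfl, rfl⟩, rfl, hpq.trans List.perm_append_comm⟩

theorem exists_of_derives_gramL₃ {k : ℕ} {w : List Letter}
    (h : Derives gramL₃.Step (.s :: replicate k .a) w []) :
    ∃ m v, w = replicate m .a ++ .s :: v ∧ Derives gramL₃.Step (replicate (k + m) .a) v [] := by
  generalize hα : (Letter.s :: replicate k .a : List gramL₃.NT) = α at h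
  generalize hε : ([] : List gramL₃.NT) = ε at h
  induction h generalizing k with
  | nil => cases hα.trans hε.symm
  | cons hstep h ih =>
    cases hstep with
    | @production X x α β hP =>
      obtain ⟨rfl, rfl⟩ := List.cons_eq_cons.1 hα
      obtain ⟨rfl, rfl⟩ | ⟨rfl, rfl⟩ : x = Letter.a ∧ α = [.s, .a] ∨ x = Letter.s ∧ α = [] := by
        simpa [prodsL₃] using hP
      · obtain ⟨m, v, rfl, hv⟩ := ih (k := k + 1) rfl hε
        exact ⟨m + 1, v, rfl, by rwa [Nat.add_right_comm] at hv⟩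
      · exact ⟨0, _, rfl, hε ▸ h⟩
    | @swap X Y p q hI =>
      have mem_of_mem {Z : Letter} (hZ : Z ∈ p ++ X :: Y :: q) : Z ∈ [Letter.s, .a] := by
        rcases List.mem_cons.1 (hα ▸ hZ) with rfl | hZ
        · simp
        · simp [List.eq_of_mem_replicate hZ]
      exact absurd ⟨mem_of_mem (by simp), mem_of_mem (by simp)⟩ hI.2

theorem derives_gramL₃_cons {X x : Letter} {α β w : List Letter} (hP : (X, x, α) ∈ prodsL₃)
    (h : Derives gramL₃.Step (α ++ β) w []) : Derives gramL₃.Step (X :: β) (x :: w) [] :=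
  .cons (PCGrammar.Step.production (G := gramL₃) β hP) h

theorem derives_gramL₃_append {k m : ℕ} {v : List Letter}
    (h : Derives gramL₃.Step (replicate (k + m) .a) v []) :
    Derives gramL₃.Step (.s :: replicate k .a) (replicate m .a ++ .s :: v) [] := by
  induction m generalizing k with
  | zero => exact derives_gramL₃_cons (α := []) (by simp [prodsL₃]) h
  | succ m ih =>
    refine derives_gramL₃_cons (α := [.s, .a]) (by simp [prodsL₃]) (ih (k := k + 1) ?_)
    rwa [Nat.add_right_comm]

theorem derives_gramL₃_replicate_iff {k : ℕ} {v : List Letter} :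
    Derives gramL₃.Step (replicate k .a) v [] ↔ v.Perm (replicate k .b ++ replicate k .c) := by
  refine (PCGrammar.derives_iff_commDerives (G := gramL₃) (S := {Letter.s}ᶜ) ?_ ?_ ?_).trans
    ⟨perm_of_commDerives_rulesBC, commDerives_rulesBC_of_perm⟩
  · rintro X hX Y hY hXY
    refine ⟨hXY, ?_⟩
    simp only [Set.mem_compl_iff, Set.mem_singleton_iff] at hX hY
    grind
  · rintro X x α hX hP
    obtain hP | hP | hP | hP | hP | hP := hP <;> obtain ⟨rfl, rfl, rfl⟩ := hP <;> simp at hX ⊢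
  · simp

theorem L₃_mem_trPCCFL : L₃ ∈ TrPCCFL Letter := by
  refine ⟨gramL₃, transitiveDependence_gramL₃, Language.ext fun w => ?_⟩
  refine Iff.trans ?_ mem_L₃_iff.symm
  constructor
  · intro h
    obtain ⟨m, v, rfl, hv⟩ := exists_of_derives_gramL₃ (k := 0) h
    exact ⟨m, v, by simpa using derives_gramL₃_replicate_iff.1 hv, rfl⟩
  · rintro ⟨n, v, hv, rfl⟩
    exact derives_gramL₃_append (k := 0) (derives_gramL₃_replicate_iff.2 (by simpa using hv))

/-! ### The language L₃ is not in shuffle-CFL -/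

namespace PATerm

variable {V : Type}

/-- The set of subterms of a term, including the term itself. -/
def subterms : PATerm V → Set (PATerm V)
  | empty => {empty}
  | var X => {var X}
  | seq t u => insert (seq t u) (t.subterms ∪ u.subterms)
  | par t u => insert (par t u) (t.subterms ∪ u.subterms)

theorem finite_subterms (t : PATerm V) : t.subterms.Finite := by
  induction t with
  | empty | var => exact Set.finite_singleton _
  | seq t u ht hu | par t u ht hu => exact (ht.union hu).insert _

theorem mem_subterms_self (t : PATerm V) : t ∈ t.subterms := by
  cases t <;> simp [subterms]

theorem subterms_subset {t u : PATerm V} (h : u ∈ t.subterms) : u.subterms ⊆ t.subterms := by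
  induction t with
  | empty | var => rw [Set.mem_singleton_iff.1 h]
  | seq t t' ih ih' | par t t' ih ih' =>
    obtain rfl | h | h := h
    · rfl
    · exact (ih h).trans (Set.subset_union_left.trans (Set.subset_insert ..))
    · exact (ih' h).trans (Set.subset_union_right.trans (Set.subset_insert ..))

end PATerm

namespace PAGrammar

/-- The subterms of right-hand sides of productions and of the initial term: the terms to which
`Yields` recurs from the initial one. -/
def subterms {T : Type} (G : PAGrammar T) : Set (PATerm G.NT) :=
  (PATerm.var G.initial).subterms ∪ ⋃ r ∈ G.productions, r.2.2.subterms

variable {T : Type} {G : PAGrammar T}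

theorem finite_subterms : G.subterms.Finite :=
  (PATerm.finite_subterms _).union
    (G.finite_productions.biUnion fun r _ => r.2.2.finite_subterms)

theorem mem_subterms_of_mem_productions {X : G.NT} {x : T} {t : PATerm G.NT}
    (h : (X, x, t) ∈ G.productions) : t ∈ G.subterms :=
  .inr (Set.mem_biUnion h t.mem_subterms_self)

theorem subterms_subset {t : PATerm G.NT} (h : t ∈ G.subterms) : t.subterms ⊆ G.subterms := by
  obtain h | h := h
  · exact (PATerm.subterms_subset h).trans Set.subset_union_left
  · obtain ⟨r, hr, h⟩ := Set.mem_iUnion₂.1 h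
    exact fun u hu => .inr (Set.mem_biUnion hr (PATerm.subterms_subset h hu))

theorem mem_subterms_of_seq_mem_subterms {t u : PATerm G.NT} (h : .seq t u ∈ G.subterms) :
    t ∈ G.subterms ∧ u ∈ G.subterms :=
  ⟨subterms_subset h (.inr (.inl t.mem_subterms_self)),
    subterms_subset h (.inr (.inr u.mem_subterms_self))⟩

theorem mem_subterms_of_par_mem_subterms {t u : PATerm G.NT} (h : .par t u ∈ G.subterms) :
    t ∈ G.subterms ∧ u ∈ G.subterms :=
  ⟨subterms_subset h (.inr (.inl t.mem_subterms_self)),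
    subterms_subset h (.inr (.inr u.mem_subterms_self))⟩

end PAGrammar

theorem imbalance_eq_zero_of_mem_L₃ {w : List Letter} (h : w ∈ L₃) : imbalance w = 0 := by
  obtain ⟨n, v, hv, rfl⟩ := mem_L₃_iff.1 h
  simp [imbalance, hv.count_eq, List.count_replicate]

theorem a_notMem_of_append_mem_L₃ {v w : List Letter} (h : v ++ w ∈ L₃) (hs : .s ∈ v) :
    .a ∉ w := by
  obtain ⟨n, u, hu, h⟩ := mem_L₃_iff.1 h
  have ha : .a ∉ u := by simp [hu.mem_iff]
  obtain ⟨r, hr, -⟩ | ⟨r, rfl, hr⟩ := List.append_eq_append_iff.1 h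
  · have hs : .s ∈ replicate n Letter.a := hr ▸ List.mem_append_left r hs
    simp at hs
  · obtain ⟨rfl, rfl⟩ | ⟨r, rfl, rfl⟩ := List.cons_eq_append_iff.1 hr
    · simp at hs
    · exact fun h => ha (List.mem_append_right r h)

theorem eq_a_of_append_mem_L₃ {v w : List Letter} (h : v ++ w ∈ L₃) (hs : .s ∈ w) :
    ∀ x ∈ v, x = .a := by
  obtain ⟨n, u, hu, h⟩ := mem_L₃_iff.1 h
  have hs' : .s ∉ u := by simp [hu.mem_iff]
  obtain ⟨r, hr, -⟩ | ⟨r, rfl, hr⟩ := List.append_eq_append_iff.1 h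
  · exact fun x hx => List.eq_of_mem_replicate (hr ▸ List.mem_append_left r hx)
  · obtain ⟨rfl, rfl⟩ | ⟨r, rfl, rfl⟩ := List.cons_eq_append_iff.1 hr
    · simp
    · exact absurd (List.mem_append_right r hs) hs'

theorem count_a_eq_zero_of_append_mem_L₃ {p v q : List Letter} (h : p ++ v ++ q ∈ L₃)
    (hs : .s ∈ p) : v.count .a = 0 :=
  List.count_eq_zero.2 fun ha =>
    a_notMem_of_append_mem_L₃ (List.append_assoc p v q ▸ h) hs (List.mem_append_left q ha)

theorem count_a_le_of_append_mem_L₃ {p v q : List Letter} {D : ℕ} (h : p ++ v ++ q ∈ L₃)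
    (hs : .s ∈ q) (hv : NearlyBalanced D v) : v.count .a ≤ D := by
  have hb : v.count .b = 0 := List.count_eq_zero.2 fun hb => by
    cases eq_a_of_append_mem_L₃ h hs .b (List.mem_append_right p hb)
  have := hv.1
  simp only [imbalance] at this
  omega

theorem eq_nil_of_interleaving_mem_L₃ {p q v w : List Letter}
    (h : ∀ x, Interleaving v w x → p ++ x ++ q ∈ L₃) (hs : .s ∈ v) : w = [] := by
  refine List.eq_nil_iff_forall_not_mem.2 fun x hx => ?_
  have hvw : (p ++ v) ++ (w ++ q) ∈ L₃ := by simpa using h _ (.append v w)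
  have hwv : (p ++ w) ++ (v ++ q) ∈ L₃ := by simpa using h _ (Interleaving.append w v).symm
  have hxa : x = .a :=
    eq_a_of_append_mem_L₃ hwv (List.mem_append_left q hs) x (List.mem_append_right p hx)
  exact a_notMem_of_append_mem_L₃ hvw (List.mem_append_right p hs)
    (List.mem_append_left q (hxa ▸ hx))

theorem eq_left_of_yields_par {G : PAGrammar Letter} {t u : PATerm G.NT} {p q v w x : List Letter}
    (hctx : ∀ x, G.Yields (.par t u) x → p ++ x ++ q ∈ L₃) (ht : G.Yields t v)
    (hu : G.Yields u w) (h : Interleaving v w x) (hs : .s ∈ v) :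
    x = v ∧ ∀ y, G.Yields t y → p ++ y ++ q ∈ L₃ := by
  have hw : w = [] := eq_nil_of_interleaving_mem_L₃ (fun x hx => hctx x (.par ht hu hx)) hs
  subst hw
  exact ⟨Interleaving.nil_right_iff.1 h,
    fun y hy => hctx y (.par hy hu (Interleaving.nil_right_iff.2 rfl))⟩

/- Descend to the part that reads `s`. A part composed in parallel with it reads nothing, a part to
its right reads no `a`, and a part to its left reads only `a`s, hence at most `D` of them. -/
theorem PAGrammar.Yields.exists_nearlyBalanced_factor {G : PAGrammar Letter} {D m : ℕ}
    (hD : ∀ t ∈ G.subterms, ∀ p q, (∀ w, G.Yields t w → p ++ w ++ q ∈ L₃) →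
      ∀ w, G.Yields t w → NearlyBalanced D w)
    {t : PATerm G.NT} {w : List Letter} (h : G.Yields t w) (ht : t ∈ G.subterms)
    {p q : List Letter} (hctx : ∀ w, G.Yields t w → p ++ w ++ q ∈ L₃) (hs : .s ∈ w)
    (hm : m ≤ w.count .a) :
    ∃ v, v <:+: w ∧ .s ∈ v ∧ NearlyBalanced D v ∧ m ≤ v.count .a ∧ v.count .a ≤ m + D + 1 := by
  by_cases hle : w.count .a ≤ m + D + 1
  · exact ⟨w, List.infix_rfl, hs, hD t ht p q hctx w h, hm, hle⟩
  match h with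
  | .empty => cases hs
  | .var (a := x) (w := w) hr h =>
    have hctx' : ∀ w, G.Yields _ w → (p ++ [x]) ++ w ++ q ∈ L₃ := fun w hw => by
      simpa using hctx _ (.var hr hw)
    rw [List.count_cons] at hle
    have hx : .s ≠ x := by
      rintro rfl
      simp [count_a_eq_zero_of_append_mem_L₃ (hctx' _ h) (by simp)] at hle
    obtain ⟨v, hv, hvs⟩ := h.exists_nearlyBalanced_factor (m := m) hD
      (mem_subterms_of_mem_productions hr) hctx' (List.mem_of_ne_of_mem hx hs)
      (by split at hle <;> omega)
    exact ⟨v, List.infix_cons hv, hvs⟩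
  | .seq (v := w₁) (w := w₂) h₁ h₂ =>
    obtain ⟨ht, hu⟩ := mem_subterms_of_seq_mem_subterms ht
    have hctx₁ : ∀ w, G.Yields _ w → p ++ w ++ (w₂ ++ q) ∈ L₃ := fun w hw => by
      simpa using hctx _ (.seq hw h₂)
    have hctx₂ : ∀ w, G.Yields _ w → (p ++ w₁) ++ w ++ q ∈ L₃ := fun w hw => by
      simpa using hctx _ (.seq h₁ hw)
    rw [List.count_append] at hle
    rcases List.mem_append.1 hs with hs | hs
    · have := count_a_eq_zero_of_append_mem_L₃ (hctx₂ _ h₂) (List.mem_append_right p hs)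
      obtain ⟨v, hv, hvs⟩ := h₁.exists_nearlyBalanced_factor (m := m) hD ht hctx₁ hs (by omega)
      exact ⟨v, hv.trans (List.prefix_append ..).isInfix, hvs⟩
    · have := count_a_le_of_append_mem_L₃ (hctx₁ _ h₁) (List.mem_append_left q hs)
        (hD _ ht p _ hctx₁ _ h₁)
      obtain ⟨v, hv, hvs⟩ := h₂.exists_nearlyBalanced_factor (m := m) hD hu hctx₂ hs (by omega)
      exact ⟨v, hv.trans (List.suffix_append ..).isInfix, hvs⟩
  | .par (v := w₁) (w := w₂) h₁ h₂ h₃ =>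
    obtain ⟨ht, hu⟩ := mem_subterms_of_par_mem_subterms ht
    rcases List.mem_append.1 (h₃.perm.mem_iff.1 hs) with hs | hs
    · obtain ⟨hw, hctx₁⟩ := eq_left_of_yields_par hctx h₁ h₂ h₃ hs
      exact hw ▸ h₁.exists_nearlyBalanced_factor hD ht hctx₁ hs (hw ▸ hm)
    · obtain ⟨hw, hctx₂⟩ :=
        eq_left_of_yields_par (fun w hw => hctx w hw.par_symm) h₂ h₁ h₃.symm hs
      exact hw ▸ h₂.exists_nearlyBalanced_factor hD hu hctx₂ hs (hw ▸ hm)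

theorem L₃_notMem_shuffleCFL : L₃ ∉ ShuffleCFL Letter := by
  rintro ⟨G, hG⟩
  have hL : ∀ w, w ∈ L₃ ↔ G.Yields (.var G.initial) w := fun w => by
    rw [← hG, PAGrammar.mem_language_iff]
  obtain ⟨D, hD⟩ := exists_nearlyBalanced G.finite_subterms fun t => {w | G.Yields t w}
  have hz : replicate (4 * D + 3) .a ++ .s :: (replicate (4 * D + 3) .b ++
      replicate (4 * D + 3) .c) ∈ L₃ := mem_L₃_iff.2 ⟨_, _, .refl _, rfl⟩
  obtain ⟨v, ⟨p, q, hv⟩, hs, hbal, hm, hm'⟩ :=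
    ((hL _).1 hz).exists_nearlyBalanced_factor (m := 2 * D + 1)
      (fun t ht p q hctx => hD t ht p q fun w hw => imbalance_eq_zero_of_mem_L₃ (hctx w hw))
      (.inl (PATerm.mem_subterms_self _)) (p := []) (q := [])
      (fun w hw => by simpa using (hL w).2 hw) (by simp)
      (by rw [List.count_append, List.count_replicate_self]; omega)
  simp only [NearlyBalanced, imbalance] at hbal
  have hc : Letter.c ∈ v := List.count_pos_iff.1 (by omega)
  have hinfix : replicate (4 * D + 3) .b <:+: v :=
    isInfix_of_mem_of_mem (x := replicate (4 * D + 3) .a ++ [.s]) (z := replicate (4 * D + 3) .c)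
      (by simpa using hv) hs (by simp) hc (by simp)
  have hcount := hinfix.sublist.count_le .b
  rw [List.count_replicate_self] at hcount
  omega

end PartialComm

theorem mainTheorem2 :
    (∃ (T : Type) (_ : Finite T),
      ¬ (PartialComm.TrPCCFL T ∩ PartialComm.ShuffleCFL T ⊆ PartialComm.TraceCFL T)) ∧
    (∃ (T : Type) (_ : Finite T),
      ¬ (PartialComm.TrPCCFL T ∩ PartialComm.TraceCFL T ⊆ PartialComm.ShuffleCFL T)) ∧
    (PartialComm.L₃ ∈ PartialComm.TrPCCFL PartialComm.Letter ∩
        PartialComm.TraceCFL PartialComm.Letter ∧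
      PartialComm.L₃ ∉ PartialComm.ShuffleCFL PartialComm.Letter) := by
  have hABC : PartialComm.shuffledABC ∈
      PartialComm.TrPCCFL PartialComm.Letter ∩ PartialComm.ShuffleCFL PartialComm.Letter :=
    ⟨PartialComm.shuffledABC_mem_trPCCFL, PartialComm.shuffledABC_mem_shuffleCFL⟩
  have hL₃ : PartialComm.L₃ ∈
      PartialComm.TrPCCFL PartialComm.Letter ∩ PartialComm.TraceCFL PartialComm.Letter :=
    ⟨PartialComm.L₃_mem_trPCCFL, PartialComm.L₃_mem_traceCFL⟩
  exact ⟨⟨PartialComm.Letter, inferInstance,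
      fun h => PartialComm.shuffledABC_notMem_traceCFL (h hABC)⟩,
    ⟨PartialComm.Letter, inferInstance, fun h => PartialComm.L₃_notMem_shuffleCFL (h hL₃)⟩,
    hL₃, PartialComm.L₃_notMem_shuffleCFL⟩
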